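/- **Lemma 10.2 (the Fackerell–Ipser equation for σ in the MBI system).** Let $M>0$ and let $\mathcal S$ be the Schwarzschild spacetime in the coordinates $(t^*,r,\theta,\varphi)$, $r>0$, $0<\theta<\pi$ (poles of the spheres excluded), with $\mu=2M/r$ and $$g=-(1-\mu)\,dt^{*2}+2\mu\,dt^*dr+(1+\mu)\,dr^2+r^2(d\theta^2+\sin^2\theta\,d\varphi^2).$$ Let $\nabla$ be its Levi-Civita connection, $\varepsilon$ its volume form (for either choice of orientation), ${}^\star\mathcal F_{\kappa\lambda}=\frac12\mathcal F^{\mu\nu}\varepsilon_{\kappa\lambda\mu\nu}$, and let $$L=(1+\mu)\partial_{t^*}+(1-\mu)\partial_r,\qquad \underline L=(1-\mu)(\partial_{t^*}-\partial_r),$$ which for $r>2M$ are $\partial_t+\partial_{r_*}$ and $\partial_t-\partial_{r_*}$ in Regge–Wheeler coordinates; thus $g(L,\underline L)=-2(1-\mu)$. Let $\slashed\varepsilon_{AB}$ be the area form induced on the spheres of constant $(t^*,r)$ by $\varepsilon(L,\underline L,\cdot,\cdot)=2(1-\mu)\,\slashed\varepsilon$, i.e. $\slashed\varepsilon=\varepsilon(\partial_r,\partial_{t^*},\cdot,\cdot)$,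 and let $\slashed\Delta$ be the Laplace–Beltrami operator of these spheres. For a two-form $\mathcal F$ put $\mathbf F=\frac12\mathcal F_{\mu\nu}\mathcal F^{\mu\nu}$, $\mathbf G=\frac14\mathcal F_{\mu\nu}{}^\star\mathcal F^{\mu\nu}$, $\ell^2=1+\mathbf F-\mathbf G^2$, $$H_\Delta^{\mu\nu\kappa\lambda}=\tfrac12\Big\{-\ell^{-2}\mathcal F^{\mu\nu}\mathcal F^{\kappa\lambda}+\mathbf G\,\ell^{-2}\big(\mathcal F^{\mu\nu}{}^\star\mathcal F^{\kappa\lambda}+{}^\star\mathcal F^{\mu\nu}\mathcal F^{\kappa\lambda}\big)-(1+\mathbf G^2\ell^{-2}){}^\star\mathcal F^{\mu\nu}{}^\star\mathcal F^{\kappa\lambda}\Big\},$$ $$H^{\mu\nu\kappa\lambda}=\tfrac12\big[g^{\mu\kappa}g^{\nu\lambda}-g^{\mu\lambda}g^{\nu\kappa}\big]+H_\Delta^{\mu\nu\kappa\lambda}.$$ Let $\mathcal F$ be a smooth two-form on an open set $U\subseteq\mathcal S$ on which $\ell^2\neq0$ (so that $H_\Delta$ is defined), satisfying there the Maxwell–Born–Infeld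 system $$\nabla_{[\mu}\mathcal F_{\nu\lambda]}=0,\qquad H^{\mu\nu\kappa\lambda}\nabla_\mu\mathcal F_{\kappa\lambda}=0.$$ Put $$W_{\eta\zeta\delta}:=-\varepsilon_\eta{}^\nu{}_{\zeta\delta}\,H_\Delta{}^\mu{}_\nu{}^{\kappa\lambda}\nabla_\mu\mathcal F_{\kappa\lambda},\qquad \mathbf{NL}_3:=L^\nu\underline L^\alpha\nabla^\mu W_{\alpha\mu\nu}.$$ Then $\sigma:=\mathcal F_{AB}\slashed\varepsilon^{AB}$ satisfies on $U$ $$-r^{-2}L\underline L(r^2\sigma)+(1-\mu)\slashed\Delta\sigma=\mathbf{NL}_3.$$ Equivalently, in the dual normalization $\sigma':=\frac1{2(1-\mu)}{}^\star\mathcal F(\underline L,L)$, which does not depend on the choice of $\slashed\varepsilon$, at all points of $U$ with $r\neq2M$, $$-r^{-2}L\underline L(r^2\sigma')+(1-\mu)\slashed\Delta\sigma'=-\tfrac12\mathbf{NL}_3.$$ -/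

import Mathlib

/-! Tensor calculus on the Schwarzschild spacetime of mass `M`, in the coordinates
`x = (t*, r, θ, φ)` (indices `0, 1, 2, 3`), with `r > 0` and the poles of the spheres excluded.
These coordinates are regular across the horizon `r = 2M`.  A tensor field is given by its
components in these coordinates. -/

open scoped ContDiff

namespace Schwarzschild

noncomputable section

/-- The coordinate domain of `(t*, r, θ, φ)`. -/
def domain : Set (Fin 4 → ℝ) := {x | 0 < x 1 ∧ 0 < x 2 ∧ x 2 < Real.pi}

/-- `μ = 2M / r`. -/
def mu (M : ℝ) (x : Fin 4 → ℝ) : ℝ := 2 * M / x 1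

/-- The Schwarzschild metric `g_{αβ}`. -/
def metric (M : ℝ) (x : Fin 4 → ℝ) : Matrix (Fin 4) (Fin 4) ℝ :=
  !![-(1 - mu M x), mu M x, 0, 0;
     mu M x, 1 + mu M x, 0, 0;
     0, 0, x 1 ^ 2, 0;
     0, 0, 0, x 1 ^ 2 * Real.sin (x 2) ^ 2]

/-- The inverse metric `g^{αβ}`, see `metric_mul_invMetric`. -/
def invMetric (M : ℝ) (x : Fin 4 → ℝ) : Matrix (Fin 4) (Fin 4) ℝ :=
  !![-(1 + mu M x), mu M x, 0, 0;
     mu M x, 1 - mu M x, 0, 0;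
     0, 0, (x 1 ^ 2)⁻¹, 0;
     0, 0, 0, (x 1 ^ 2 * Real.sin (x 2) ^ 2)⁻¹]

theorem metric_mul_invMetric (M : ℝ) (x : Fin 4 → ℝ) (hx : x ∈ domain) :
    metric M x * invMetric M x = 1 := by
  have h1 : x 1 ≠ 0 := ne_of_gt hx.1
  have h2 : Real.sin (x 2) ≠ 0 := ne_of_gt (Real.sin_pos_of_pos_of_lt_pi hx.2.1 hx.2.2)
  ext i j
  fin_cases i <;> fin_cases j <;>
    simp [metric, invMetric, Matrix.mul_apply, Fin.sum_univ_four] <;> field_simp <;> ring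

/-- The coordinate derivative `∂_i f`. -/
def pd (i : Fin 4) (f : (Fin 4 → ℝ) → ℝ) (x : Fin 4 → ℝ) : ℝ := fderiv ℝ f x (Pi.single i 1)

/-- The Christoffel symbols `Γ^κ_{αβ}` of the Levi-Civita connection of `g`. -/
def christoffel (M : ℝ) (κ α β : Fin 4) (x : Fin 4 → ℝ) : ℝ :=
  (1 / 2) * ∑ δ, invMetric M x κ δ *
    (pd α (fun y => metric M y δ β) x + pd β (fun y => metric M y δ α) x
      - pd δ (fun y => metric M y α β) x)

/-- The covariant derivative `∇_κ T_{αβ}` of a covariant 2-tensor. -/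
def nabla₂ (M : ℝ) (T : (Fin 4 → ℝ) → Fin 4 → Fin 4 → ℝ) (x : Fin 4 → ℝ) (κ α β : Fin 4) : ℝ :=
  pd κ (fun y => T y α β) x
    - ∑ δ, christoffel M δ κ α x * T x δ β - ∑ δ, christoffel M δ κ β x * T x α δ

/-- The covariant derivative `∇_κ T_{αβγ}` of a covariant 3-tensor. -/
def nabla₃ (M : ℝ) (T : (Fin 4 → ℝ) → Fin 4 → Fin 4 → Fin 4 → ℝ) (x : Fin 4 → ℝ)
    (κ α β γ : Fin 4) : ℝ :=
  pd κ (fun y => T y α β γ) x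
    - ∑ δ, christoffel M δ κ α x * T x δ β γ - ∑ δ, christoffel M δ κ β x * T x α δ γ
    - ∑ δ, christoffel M δ κ γ x * T x α β δ

/-- Raising both indices of a covariant 2-tensor. -/
def raise₂ (M : ℝ) (T : (Fin 4 → ℝ) → Fin 4 → Fin 4 → ℝ) (x : Fin 4 → ℝ) (α β : Fin 4) : ℝ :=
  ∑ κ, ∑ δ, invMetric M x α κ * invMetric M x β δ * T x κ δ

/-- The density `√|det g|`, see `sqrt_abs_det_metric`. -/
def volDensity (x : Fin 4 → ℝ) : ℝ := x 1 ^ 2 * Real.sin (x 2)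

theorem sqrt_abs_det_metric (M : ℝ) (x : Fin 4 → ℝ) (hx : x ∈ domain) :
    Real.sqrt |(metric M x).det| = volDensity x := by
  have h2 : 0 < Real.sin (x 2) := Real.sin_pos_of_pos_of_lt_pi hx.2.1 hx.2.2
  have hd : (metric M x).det = -(volDensity x) ^ 2 := by
    simp [metric, volDensity, Matrix.det_succ_row_zero, Fin.sum_univ_succ, Fin.succAbove]
    ring
  have hp : 0 ≤ volDensity x := by unfold volDensity; positivity
  rw [hd, abs_neg, abs_of_nonneg (by positivity), Real.sqrt_sq hp]

/-- The permutation symbol `[αβγδ]`, with `[0123] = 1`. -/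
def permSymbol (α β γ δ : Fin 4) : ℝ :=
  Matrix.det (Matrix.of fun i j : Fin 4 => if ![α, β, γ, δ] i = j then (1 : ℝ) else 0)

/-- The volume form `ε_{αβγδ}` of `g` for the orientation `o`; for `o = 1` the frame
`(∂_{t*}, ∂_r, ∂_θ, ∂_φ)` is positively oriented. -/
def vol (o : ℤˣ) (x : Fin 4 → ℝ) (α β γ δ : Fin 4) : ℝ :=
  ((o : ℤ) : ℝ) * volDensity x * permSymbol α β γ δ

/-- The Hodge dual `⋆F_{κλ} = ½ F^{μν} ε_{κλμν}`. -/
def hodge (M : ℝ) (o : ℤˣ) (F : (Fin 4 → ℝ) → Fin 4 → Fin 4 → ℝ) (x : Fin 4 → ℝ)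
    (κ l : Fin 4) : ℝ :=
  (1 / 2) * ∑ m, ∑ n, raise₂ M F x m n * vol o x κ l m n

/-- The invariant `𝐅 = ½ F_{μν} F^{μν}`. -/
def invF (M : ℝ) (F : (Fin 4 → ℝ) → Fin 4 → Fin 4 → ℝ) (x : Fin 4 → ℝ) : ℝ :=
  (1 / 2) * ∑ m, ∑ n, F x m n * raise₂ M F x m n

/-- The invariant `𝐆 = ¼ F_{μν} ⋆F^{μν}`. -/
def invG (M : ℝ) (o : ℤˣ) (F : (Fin 4 → ℝ) → Fin 4 → Fin 4 → ℝ) (x : Fin 4 → ℝ) : ℝ :=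
  (1 / 4) * ∑ m, ∑ n, F x m n * raise₂ M (hodge M o F) x m n

/-- `ℓ² = 1 + 𝐅 - 𝐆²`. -/
def ellSq (M : ℝ) (o : ℤˣ) (F : (Fin 4 → ℝ) → Fin 4 → Fin 4 → ℝ) (x : Fin 4 → ℝ) : ℝ :=
  1 + invF M F x - invG M o F x ^ 2

/-- The tensor `H_Δ^{μνκλ}[F]`. -/
def HDelta (M : ℝ) (o : ℤˣ) (F : (Fin 4 → ℝ) → Fin 4 → Fin 4 → ℝ) (x : Fin 4 → ℝ)
    (m n κ l : Fin 4) : ℝ :=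
  (1 / 2) *
    (-(ellSq M o F x)⁻¹ * raise₂ M F x m n * raise₂ M F x κ l
      + invG M o F x * (ellSq M o F x)⁻¹ *
        (raise₂ M F x m n * raise₂ M (hodge M o F) x κ l
          + raise₂ M (hodge M o F) x m n * raise₂ M F x κ l)
      - (1 + invG M o F x ^ 2 * (ellSq M o F x)⁻¹) *
        raise₂ M (hodge M o F) x m n * raise₂ M (hodge M o F) x κ l)

/-- The tensor `H^{μνκλ}[F] = ½ (g^{μκ} g^{νλ} - g^{μλ} g^{νκ}) + H_Δ^{μνκλ}[F]`. -/
def H (M : ℝ) (o : ℤˣ) (F : (Fin 4 → ℝ) → Fin 4 → Fin 4 → ℝ) (x : Fin 4 → ℝ)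
    (m n κ l : Fin 4) : ℝ :=
  (1 / 2) * (invMetric M x m κ * invMetric M x n l - invMetric M x m l * invMetric M x n κ)
    + HDelta M o F x m n κ l

/-- `F` is (the components of) a smooth two-form on `U`. -/
def IsSmoothTwoForm (F : (Fin 4 → ℝ) → Fin 4 → Fin 4 → ℝ) (U : Set (Fin 4 → ℝ)) : Prop :=
  (∀ m n, ContDiffOn ℝ ∞ (fun x => F x m n) U) ∧ ∀ x ∈ U, ∀ m n, F x m n = -F x n m

/-- The Maxwell-Born-Infeld system on `U`: `∇_{[μ} F_{νλ]} = 0` and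
`H^{μνκλ}[F] ∇_μ F_{κλ} = 0`. -/
def SolvesMBI (M : ℝ) (o : ℤˣ) (F : (Fin 4 → ℝ) → Fin 4 → Fin 4 → ℝ)
    (U : Set (Fin 4 → ℝ)) : Prop :=
  (∀ x ∈ U, ∀ m n l, nabla₂ M F x m n l + nabla₂ M F x n l m + nabla₂ M F x l m n = 0) ∧
  ∀ x ∈ U, ∀ n, ∑ m, ∑ κ, ∑ l, H M o F x m n κ l * nabla₂ M F x m κ l = 0

/-- The null vector field `L`, which is `∂_t + ∂_{r_*}` in Regge-Wheeler coordinates. -/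
def L (M : ℝ) (x : Fin 4 → ℝ) : Fin 4 → ℝ := ![1 + mu M x, 1 - mu M x, 0, 0]

/-- The null vector field `L̲`, which is `∂_t - ∂_{r_*}` in Regge-Wheeler coordinates. -/
def Lbar (M : ℝ) (x : Fin 4 → ℝ) : Fin 4 → ℝ := ![1 - mu M x, -(1 - mu M x), 0, 0]

/-- The directional derivative `V f` of a function along a vector field. -/
def along (V : (Fin 4 → ℝ) → Fin 4 → ℝ) (f : (Fin 4 → ℝ) → ℝ) (x : Fin 4 → ℝ) : ℝ :=
  ∑ m, V x m * pd m f x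

/-- The Laplace-Beltrami operator of the round sphere of radius `r` (`t*` and `r` fixed). -/
def sphereLaplacian (f : (Fin 4 → ℝ) → ℝ) (x : Fin 4 → ℝ) : ℝ :=
  (x 1 ^ 2)⁻¹ *
    ((Real.sin (x 2))⁻¹ * pd 2 (fun y => Real.sin (y 2) * pd 2 f y) x
      + (Real.sin (x 2) ^ 2)⁻¹ * pd 3 (pd 3 f) x)

/-- The area form of the spheres of constant `(t*, r)` induced by `ε`, extended by zero to the
directions `∂_{t*}`, `∂_r`: the contraction `ε(∂_r, ∂_{t*}, ·, ·)`.  It is characterized by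
`ε(L, L̲, ·, ·) = 2 (1 - μ) areaForm`, see `vol_L_Lbar`. -/
def areaForm (o : ℤˣ) (x : Fin 4 → ℝ) (A B : Fin 4) : ℝ := vol o x 1 0 A B

theorem permSymbol_swap (α β γ δ : Fin 4) : permSymbol β α γ δ = -permSymbol α β γ δ := by
  have h := Matrix.det_permute (Equiv.swap (0 : Fin 4) 1)
    (Matrix.of fun i j : Fin 4 => if ![α, β, γ, δ] i = j then (1 : ℝ) else 0)
  rw [Equiv.Perm.sign_swap (by decide)] at h
  simp only [Units.val_neg, Units.val_one, Int.cast_neg, Int.cast_one, neg_mul, one_mul] at h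
  unfold permSymbol
  rw [← h]
  congr 1
  ext i j
  fin_cases i <;> simp [Matrix.submatrix, Equiv.swap_apply_def] <;> rfl

theorem vol_L_Lbar (M : ℝ) (o : ℤˣ) (x : Fin 4 → ℝ) (A B : Fin 4) :
    ∑ m, ∑ n, L M x m * Lbar M x n * vol o x m n A B = 2 * (1 - mu M x) * areaForm o x A B := by
  have h0 : permSymbol 0 0 A B = 0 := by linarith [permSymbol_swap 0 0 A B]
  have h1 : permSymbol 1 1 A B = 0 := by linarith [permSymbol_swap 1 1 A B]
  simp only [Fin.sum_univ_four, L, Lbar, vol, areaForm, permSymbol_swap 1 0 A B, h0, h1]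
  simp
  ring

/-- The middle component `σ = F_{AB} ε̸^{AB}`. -/
def sigma (M : ℝ) (o : ℤˣ) (F : (Fin 4 → ℝ) → Fin 4 → Fin 4 → ℝ) (x : Fin 4 → ℝ) : ℝ :=
  ∑ A, ∑ B, F x A B * raise₂ M (areaForm o) x A B

/-- The middle component in its dual normalization, `(2 (1 - μ))⁻¹ ⋆F(L̲, L)`. -/
def sigmaDual (M : ℝ) (o : ℤˣ) (F : (Fin 4 → ℝ) → Fin 4 → Fin 4 → ℝ) (x : Fin 4 → ℝ) : ℝ :=
  (2 * (1 - mu M x))⁻¹ * ∑ m, ∑ n, hodge M o F x m n * Lbar M x m * L M x n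

/-- The nonlinear current `H_Δ^μ_ν^{κλ} ∇_μ F_{κλ}`. -/
def current (M : ℝ) (o : ℤˣ) (F : (Fin 4 → ℝ) → Fin 4 → Fin 4 → ℝ) (x : Fin 4 → ℝ)
    (n : Fin 4) : ℝ :=
  ∑ m, ∑ δ, ∑ κ, ∑ l, metric M x n δ * HDelta M o F x m δ κ l * nabla₂ M F x m κ l

/-- `W_{ηζδ} = -ε_η^ν_{ζδ} H_Δ^μ_ν^{κλ} ∇_μ F_{κλ}`. -/
def W (M : ℝ) (o : ℤˣ) (F : (Fin 4 → ℝ) → Fin 4 → Fin 4 → ℝ) (x : Fin 4 → ℝ)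
    (η ζ δ : Fin 4) : ℝ :=
  -∑ n, ∑ β, vol o x η β ζ δ * invMetric M x β n * current M o F x n

/-- `NL₃ = L^ν L̲^α ∇^μ W_{αμν}`. -/
def NL₃ (M : ℝ) (o : ℤˣ) (F : (Fin 4 → ℝ) → Fin 4 → Fin 4 → ℝ) (x : Fin 4 → ℝ) : ℝ :=
  ∑ n, ∑ α, L M x n * Lbar M x α *
    ∑ m, ∑ κ, invMetric M x m κ * nabla₃ M (W M o F) x κ α m n

/-- The Fackerell-Ipser operator `s ↦ -r⁻² L L̲ (r² s) + (1 - μ) Δ̸ s`. -/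
def fackerellIpser (M : ℝ) (s : (Fin 4 → ℝ) → ℝ) (x : Fin 4 → ℝ) : ℝ :=
  -(x 1 ^ 2)⁻¹ * along (L M) (along (Lbar M) (fun y => y 1 ^ 2 * s y)) x
    + (1 - mu M x) * sphereLaplacian s x

end

end Schwarzschild

/-! The second Maxwell–Born–Infeld equation says `∇^μ F_{μν} = -J_ν`, with `J` the nonlinear
current `current`, because `H` is the identity on two-forms plus `H_Δ`
(`current_eq_neg_div`).  The tensor `W` is, up to sign, the Hodge dual of `J`, and `L`, `L̲` span the
`(t*, r)`-plane off the horizon; on the horizon both sides below vanish.  Hence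
`L^ν L̲^α ∇^μ W_{αμν}` only sees the angular part of `dJ`, and all Christoffel symbols drop out
(`NL₃_eq_curl`): `NL₃ = 2 o (1 - μ) / (r² sin θ) * (∂_θ J_φ - ∂_φ J_θ)`, where `o = ±1` is the
orientation.

On the other side `σ = -2 o F_{θφ} / (r² sin θ)` (`sigma_eq`), and the Fackerell–Ipser operator acts
on such a function through `∂_a (g^{ab} ∂_b F_{θφ})`, `a, b ∈ {t*, r}`, and angular derivatives of
`F_{θφ}` (`fackerellIpser_eq`).  The equation `dF = 0` gives `∂_a F_{θφ} = ∂_θ F_{aφ} - ∂_φ F_{aθ}`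
(`IsSmoothTwoForm.pd_cyclic`), which turns the former into the curl of `∂_a (g^{ab} F_{bA})`.  These
are, up to sign, the terms of `J_θ` and `J_φ` (`current_two`, `current_three`) with a contraction over
`(t*, r)`; the remaining terms of `J_θ` and `J_φ` give the spherical Laplacian of `σ`.  For the dual
normalization, `σ' = -σ / 2` away from the horizon (`sigmaDual_eq`). -/

open Topology

namespace Schwarzschild

/-! ### Calculus of coordinate derivatives -/

/-- `f` is differentiable at `x` with `∂_i f (x) = d`.  Full differentiability is part of the notion,
so that the rules below compose and `pd i f x` is not a junk value. -/
structure HasPd (i : Fin 4) (f : (Fin 4 → ℝ) → ℝ) (d : ℝ) (x : Fin 4 → ℝ) : Prop where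
  diff : DifferentiableAt ℝ f x
  eq : pd i f x = d

section HasPd

variable {i : Fin 4} {f g : (Fin 4 → ℝ) → ℝ} {a b : ℝ} {x : Fin 4 → ℝ}

theorem HasPd.of_differentiableAt (h : DifferentiableAt ℝ f x) (i : Fin 4) :
    HasPd i f (pd i f x) x := ⟨h, rfl⟩

theorem pd_congr (h : f =ᶠ[𝓝 x] g) (i : Fin 4) : pd i f =ᶠ[𝓝 x] pd i g :=
  (h.fderiv (𝕜 := ℝ)).mono fun y hy => by simp only [pd, hy]

theorem HasPd.congr (h : HasPd i f a x) (hfg : g =ᶠ[𝓝 x] f) : HasPd i g a x :=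
  ⟨h.diff.congr_of_eventuallyEq hfg, (pd_congr hfg i).eq_of_nhds.trans h.eq⟩

theorem hasPd_const (c : ℝ) : HasPd i (fun _ => c) 0 x :=
  ⟨differentiableAt_const c, by simp [pd]⟩

theorem hasPd_coord (j : Fin 4) : HasPd i (fun y => y j) (if j = i then 1 else 0) x :=
  ⟨differentiableAt_apply j x, by
    simp only [pd]
    rw [(hasFDerivAt_apply (𝕜 := ℝ) j x).fderiv]
    simp [Pi.single_apply]⟩

theorem HasPd.add (hf : HasPd i f a x) (hg : HasPd i g b x) :
    HasPd i (fun y => f y + g y) (a + b) x :=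
  ⟨hf.diff.add hg.diff, by
    rw [← hf.eq, ← hg.eq]; simp only [pd]; rw [fderiv_fun_add hf.diff hg.diff]; rfl⟩

theorem HasPd.sub (hf : HasPd i f a x) (hg : HasPd i g b x) :
    HasPd i (fun y => f y - g y) (a - b) x :=
  ⟨hf.diff.sub hg.diff, by
    rw [← hf.eq, ← hg.eq]; simp only [pd]; rw [fderiv_fun_sub hf.diff hg.diff]; rfl⟩

theorem HasPd.neg (hf : HasPd i f a x) : HasPd i (fun y => -f y) (-a) x :=
  ⟨hf.diff.neg, by rw [← hf.eq]; simp only [pd]; rw [fderiv_fun_neg]; rfl⟩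

theorem HasPd.mul (hf : HasPd i f a x) (hg : HasPd i g b x) :
    HasPd i (fun y => f y * g y) (a * g x + f x * b) x :=
  ⟨hf.diff.mul hg.diff, by
    rw [← hf.eq, ← hg.eq]; simp only [pd]; rw [fderiv_fun_mul hf.diff hg.diff]
    simp; ring⟩

theorem HasPd.sq (hf : HasPd i f a x) : HasPd i (fun y => f y ^ 2) (2 * f x * a) x := by
  have h := hf.mul hf
  simp only [pow_two]
  exact ⟨h.diff, h.eq.trans (by ring)⟩

theorem HasPd.comp_hasDerivAt {φ : ℝ → ℝ} (hφ : HasDerivAt φ b (f x)) (hf : HasPd i f a x) :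
    HasPd i (fun y => φ (f y)) (b * a) x := by
  have h := hφ.comp_hasFDerivAt x hf.diff.hasFDerivAt
  refine ⟨h.differentiableAt, ?_⟩
  rw [← hf.eq]
  change (fderiv ℝ (φ ∘ f) x) _ = _
  rw [h.fderiv]; rfl

end HasPd

theorem hasPd_inv_r {x : Fin 4 → ℝ} (hx : x 1 ≠ 0) (i : Fin 4) :
    HasPd i (fun y => (y 1)⁻¹) (-(x 1 ^ 2)⁻¹ * (if 1 = i then 1 else 0)) x :=
  HasPd.comp_hasDerivAt (hasDerivAt_inv hx) (hasPd_coord 1)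

theorem hasPd_mu (M : ℝ) {x : Fin 4 → ℝ} (hx : x 1 ≠ 0) (i : Fin 4) :
    HasPd i (mu M) (-(mu M x / x 1) * (if 1 = i then 1 else 0)) x := by
  have h := (hasPd_const (2 * M)).mul (hasPd_inv_r hx i)
  have e : mu M = fun y => 2 * M * (y 1)⁻¹ := by funext y; simp [mu, div_eq_mul_inv]
  rw [e]
  exact ⟨h.diff, by rw [h.eq]; field_simp; ring⟩

theorem hasPd_sin (x : Fin 4 → ℝ) (i : Fin 4) :
    HasPd i (fun y => Real.sin (y 2)) (Real.cos (x 2) * (if 2 = i then 1 else 0)) x :=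
  HasPd.comp_hasDerivAt (Real.hasDerivAt_sin _) (hasPd_coord 2)

theorem hasPd_cos (x : Fin 4 → ℝ) (i : Fin 4) :
    HasPd i (fun y => Real.cos (y 2)) (-Real.sin (x 2) * (if 2 = i then 1 else 0)) x :=
  HasPd.comp_hasDerivAt (Real.hasDerivAt_cos _) (hasPd_coord 2)

theorem hasPd_inv_sin {x : Fin 4 → ℝ} (hx : Real.sin (x 2) ≠ 0) (i : Fin 4) :
    HasPd i (fun y => (Real.sin (y 2))⁻¹)
      (-(Real.sin (x 2) ^ 2)⁻¹ * (Real.cos (x 2) * (if 2 = i then 1 else 0))) x :=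
  HasPd.comp_hasDerivAt (hasDerivAt_inv hx) (hasPd_sin x i)

/-- The second partial derivatives of a `C²` function commute. -/
theorem pd_comm {f : (Fin 4 → ℝ) → ℝ} {x : Fin 4 → ℝ} (h : ContDiffAt ℝ 2 f x) (i j : Fin 4) :
    pd i (pd j f) x = pd j (pd i f) x := by
  have hd : DifferentiableAt ℝ (fderiv ℝ f) x :=
    (h.fderiv_right (m := 1) (by norm_num)).differentiableAt (by norm_num)
  have key : ∀ k l : Fin 4, pd k (pd l f) x
      = fderiv ℝ (fderiv ℝ f) x (Pi.single k 1) (Pi.single l 1) := by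
    intro k l
    change fderiv ℝ (fun y => fderiv ℝ f y (Pi.single l 1)) x _ = _
    rw [fderiv_clm_apply hd (differentiableAt_const _)]
    simp
  rw [key, key]
  exact (h.isSymmSndFDerivAt (by simp)) _ _

theorem contDiffAt_pd {f : (Fin 4 → ℝ) → ℝ} {x : Fin 4 → ℝ} (h : ContDiffAt ℝ ∞ f x) (i : Fin 4) :
    ContDiffAt ℝ ∞ (pd i f) x :=
  (h.fderiv_right (m := ∞) (by simp)).clm_apply contDiffAt_const

/-! ### The Schwarzschild connection and the permutation symbol -/

/-- The derivatives `∂_k g_{ij}` of the Schwarzschild metric. -/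
theorem pd_metric (M : ℝ) {x : Fin 4 → ℝ} (hx : x ∈ domain) (k i j : Fin 4) :
    pd k (fun y => metric M y i j) x =
      (if 1 = k then
        !![-(mu M x / x 1), -(mu M x / x 1), 0, 0;
          -(mu M x / x 1), -(mu M x / x 1), 0, 0;
          0, 0, 2 * x 1, 0;
          0, 0, 0, 2 * x 1 * Real.sin (x 2) ^ 2] i j else 0) +
      (if 2 = k then
        !![0, 0, 0, 0; 0, 0, 0, 0; 0, 0, 0, 0;
          0, 0, 0, 2 * x 1 ^ 2 * Real.sin (x 2) * Real.cos (x 2)] i j else 0) := by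
  have h1 : x 1 ≠ 0 := hx.1.ne'
  have hmu := hasPd_mu M h1 k
  have hr : HasPd k (fun y => y 1) _ x := hasPd_coord 1
  have hs := hasPd_sin x k
  have e0 : pd k (fun _ => (0 : ℝ)) x = 0 := (hasPd_const 0).eq
  have e1 : pd k (fun y => mu M y - 1) x = _ := (hmu.sub (hasPd_const 1)).eq
  have e2 : pd k (fun y => mu M y) x = _ := hmu.eq
  have e3 : pd k (fun y => 1 + mu M y) x = _ := ((hasPd_const 1).add hmu).eq
  have e4 : pd k (fun y => y 1 ^ 2) x = _ := hr.sq.eq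
  have e5 : pd k (fun y => y 1 ^ 2 * Real.sin (y 2) ^ 2) x = _ := (hr.sq.mul hs.sq).eq
  fin_cases i <;> fin_cases j <;>
    simp [metric, e0, e1, e2, e3, e4, e5] <;> (try split_ifs) <;> (try simp) <;> (try ring)

/-- The Christoffel symbols of the Schwarzschild metric, as the matrices `Γ^κ`. -/
theorem christoffel_eq (M : ℝ) {x : Fin 4 → ℝ} (hx : x ∈ domain) (κ α β : Fin 4) :
    christoffel M κ α β x =
      (![!![mu M x ^ 2 / (2 * x 1), mu M x * (1 + mu M x) / (2 * x 1), 0, 0;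
          mu M x * (1 + mu M x) / (2 * x 1), mu M x * (2 + mu M x) / (2 * x 1), 0, 0;
          0, 0, -(mu M x * x 1), 0;
          0, 0, 0, -(mu M x * x 1 * Real.sin (x 2) ^ 2)],
        !![mu M x * (1 - mu M x) / (2 * x 1), -(mu M x ^ 2 / (2 * x 1)), 0, 0;
          -(mu M x ^ 2 / (2 * x 1)), -(mu M x * (1 + mu M x) / (2 * x 1)), 0, 0;
          0, 0, -((1 - mu M x) * x 1), 0;
          0, 0, 0, -((1 - mu M x) * x 1 * Real.sin (x 2) ^ 2)],
        !![0, 0, 0, 0;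
          0, 0, (x 1)⁻¹, 0;
          0, (x 1)⁻¹, 0, 0;
          0, 0, 0, -(Real.sin (x 2) * Real.cos (x 2))],
        !![0, 0, 0, 0;
          0, 0, 0, (x 1)⁻¹;
          0, 0, 0, Real.cos (x 2) / Real.sin (x 2);
          0, (x 1)⁻¹, Real.cos (x 2) / Real.sin (x 2), 0]] : Fin 4 → Matrix (Fin 4) (Fin 4) ℝ)
        κ α β := by
  have h1 : x 1 ≠ 0 := hx.1.ne'
  have h2 : Real.sin (x 2) ≠ 0 := (Real.sin_pos_of_pos_of_lt_pi hx.2.1 hx.2.2).ne'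
  unfold christoffel
  simp only [pd_metric M hx, Fin.sum_univ_four, invMetric]
  fin_cases κ <;> fin_cases α <;> fin_cases β <;>
    simp <;> (try field_simp) <;> (try ring)

/-- The permutation symbol as a Vandermonde product, normalized by that of `(0, 1, 2, 3)`, which is
`12`. The right side can be evaluated on numerals. -/
theorem permSymbol_eq (α β γ δ : Fin 4) :
    permSymbol α β γ δ =
      ((((β : ℤ) - α) * (γ - α) * (δ - α) * (γ - β) * (δ - β) * (δ - γ) / 12 : ℤ) : ℝ) := by
  have h : ∀ α β γ δ : Fin 4,
      Matrix.det (Matrix.of fun i j : Fin 4 => if ![α, β, γ, δ] i = j then (1 : ℤ) else 0)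
        = ((β : ℤ) - α) * (γ - α) * (δ - α) * (γ - β) * (δ - β) * (δ - γ) / 12 := by
    decide +kernel
  rw [← h]
  unfold permSymbol
  rw [Int.cast_det]
  congr 1
  ext i j
  simp

/-! ### The nonlinear current -/

variable {M : ℝ} {o : ℤˣ} {F : (Fin 4 → ℝ) → Fin 4 → Fin 4 → ℝ} {x : Fin 4 → ℝ}

theorem isOpen_domain : IsOpen domain :=
  (isOpen_lt continuous_const (continuous_apply 1)).inter
    ((isOpen_lt continuous_const (continuous_apply 2)).inter
      (isOpen_lt (continuous_apply 2) continuous_const))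

theorem W_eq (M : ℝ) (o : ℤˣ) (F : (Fin 4 → ℝ) → Fin 4 → Fin 4 → ℝ) (x : Fin 4 → ℝ)
    (η ζ δ : Fin 4) :
    W M o F x η ζ δ = -(((o : ℤ) : ℝ) * volDensity x *
      ∑ β, permSymbol η β ζ δ * ∑ n, invMetric M x β n * current M o F x n) := by
  simp only [W, vol, Finset.mul_sum]
  rw [Finset.sum_comm]
  simp only [mul_assoc]

/-- The right side of the Fackerell–Ipser equation is the curl of the angular part of the current.
Up to sign `W` is the Hodge dual of the current, so contracting with `L` and `L̲` leaves only the
angular directions, in which the symmetric Christoffel symbols cancel. -/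
theorem NL₃_eq_curl (hx : x ∈ domain)
    (h2 : DifferentiableAt ℝ (fun y => current M o F y 2) x)
    (h3 : DifferentiableAt ℝ (fun y => current M o F y 3) x) :
    NL₃ M o F x = 2 * ((o : ℤ) : ℝ) * (1 - mu M x) / (x 1 ^ 2 * Real.sin (x 2)) *
      (pd 2 (fun y => current M o F y 3) x - pd 3 (fun y => current M o F y 2) x) := by
  have h1 : x 1 ≠ 0 := hx.1.ne'
  have hs : Real.sin (x 2) ≠ 0 := (Real.sin_pos_of_pos_of_lt_pi hx.2.1 hx.2.2).ne'
  have hU : ∀ᶠ y in 𝓝 x, y ∈ domain := isOpen_domain.mem_nhds hx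
  -- The components of `W` that vanish identically.
  have w0 : ∀ i a b c, (a = b ∨ b = c ∨ a = c ∨ (a < 2 ∧ b < 2 ∧ c < 2)) →
      pd i (fun y => W M o F y a b c) x = 0 := by
    intro i a b c h
    have hp : ∀ β, permSymbol a β b c = 0 := by
      intro β
      rw [permSymbol_eq]
      revert a b c β
      norm_cast
    have : (fun y => W M o F y a b c) = fun _ => 0 := by
      funext y
      simp [W_eq, hp]
    rw [this]
    exact (hasPd_const 0).eq
  -- `√|g| J^φ = J_φ / sin θ`, and `√|g| J^θ = sin θ J_θ` in `w3`.
  have w2 : ∀ a b : Fin 4, a < 2 → b < 2 → pd 2 (fun y => W M o F y a 2 b) x =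
      -(((o : ℤ) : ℝ) * permSymbol a 3 2 b) * (pd 2 (fun y => current M o F y 3) x
        * (Real.sin (x 2))⁻¹ - current M o F x 3 * Real.cos (x 2) * (Real.sin (x 2) ^ 2)⁻¹) := by
    intro a b ha hb
    have hp : ∀ β, β ≠ 3 → permSymbol a β 2 b = 0 := by
      intro β
      rw [permSymbol_eq]
      revert a b β
      norm_cast
    have h := (hasPd_const (i := 2) (x := x) (-(((o : ℤ) : ℝ) * permSymbol a 3 2 b))).mul
      ((HasPd.of_differentiableAt h3 2).mul (hasPd_inv_sin hs 2))
    refine (h.congr (hU.mono fun y hy => ?_)).eq.trans (by simp only [if_true]; ring)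
    have h1 : y 1 ≠ 0 := hy.1.ne'
    have hs : Real.sin (y 2) ≠ 0 := (Real.sin_pos_of_pos_of_lt_pi hy.2.1 hy.2.2).ne'
    simp [W_eq, Fin.sum_univ_four, hp 0, hp 1, hp 2, invMetric, volDensity]
    field_simp
  have w3 : ∀ a b : Fin 4, a < 2 → b < 2 → pd 3 (fun y => W M o F y a 3 b) x =
      -(((o : ℤ) : ℝ) * permSymbol a 2 3 b) * (pd 3 (fun y => current M o F y 2) x
        * Real.sin (x 2)) := by
    intro a b ha hb
    have hp : ∀ β, β ≠ 2 → permSymbol a β 3 b = 0 := by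
      intro β
      rw [permSymbol_eq]
      revert a b β
      norm_cast
    have h := (hasPd_const (i := 3) (x := x) (-(((o : ℤ) : ℝ) * permSymbol a 2 3 b))).mul
      ((HasPd.of_differentiableAt h2 3).mul (hasPd_sin x 3))
    refine (h.congr (hU.mono fun y hy => ?_)).eq.trans (by simp)
    have h1 : y 1 ≠ 0 := hy.1.ne'
    simp [W_eq, Fin.sum_univ_four, hp 0, hp 1, hp 3, invMetric, volDensity]
    field_simp
  simp only [NL₃, Fin.sum_univ_four, L, Lbar, invMetric, Matrix.of_apply, Matrix.cons_val,
    zero_mul, mul_zero, add_zero, zero_add, nabla₃, christoffel_eq M hx]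
  simp (disch := decide) only [w0, w2, w3]
  simp only [W_eq, Fin.sum_univ_four, permSymbol_eq, invMetric, Matrix.of_apply, Matrix.cons_val]
  norm_num
  simp only [volDensity]
  field_simp
  ring

/-- The second Maxwell–Born–Infeld equation says `∇^μ F_{μν} = -J_ν` with the nonlinear current `J`.
The antisymmetry of `∇F` merges the two halves of the linear part of `H`. -/
theorem current_eq_neg_div (hx : x ∈ domain)
    (hanti : ∀ m κ l, nabla₂ M F x m l κ = -nabla₂ M F x m κ l)
    (hH : ∀ n, ∑ m, ∑ κ, ∑ l, H M o F x m n κ l * nabla₂ M F x m κ l = 0) (n : Fin 4) :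
    current M o F x n = -∑ m, ∑ κ, invMetric M x m κ * nabla₂ M F x m κ n := by
  have hX : ∀ δ, ∑ m, ∑ κ, ∑ l, HDelta M o F x m δ κ l * nabla₂ M F x m κ l =
      -∑ l, invMetric M x δ l * ∑ m, ∑ κ, invMetric M x m κ * nabla₂ M F x m κ l := by
    intro δ
    have e1 : ∑ m, ∑ κ, ∑ l, invMetric M x m κ * invMetric M x δ l * nabla₂ M F x m κ l
        = ∑ l, invMetric M x δ l * ∑ m, ∑ κ, invMetric M x m κ * nabla₂ M F x m κ l := by
      simp only [Finset.mul_sum]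
      rw [Finset.sum_comm (s := Finset.univ) (t := Finset.univ)
        (f := fun l m => ∑ κ, invMetric M x δ l * (invMetric M x m κ * nabla₂ M F x m κ l))]
      refine Finset.sum_congr rfl fun m _ => ?_
      rw [Finset.sum_comm]
      refine Finset.sum_congr rfl fun l _ => Finset.sum_congr rfl fun κ _ => ?_
      ring
    have e2 : ∑ m, ∑ κ, ∑ l, invMetric M x m l * invMetric M x δ κ * nabla₂ M F x m κ l
        = -∑ m, ∑ κ, ∑ l, invMetric M x m κ * invMetric M x δ l * nabla₂ M F x m κ l := by
      rw [← Finset.sum_neg_distrib]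
      refine Finset.sum_congr rfl fun m _ => ?_
      rw [Finset.sum_comm, ← Finset.sum_neg_distrib]
      refine Finset.sum_congr rfl fun κ _ => ?_
      rw [← Finset.sum_neg_distrib]
      refine Finset.sum_congr rfl fun l _ => ?_
      rw [hanti m κ l]; ring
    have h := hH δ
    simp only [H, add_mul, Finset.sum_add_distrib, sub_mul, mul_sub, mul_assoc,
      Finset.sum_sub_distrib, ← Finset.mul_sum] at h
    simp only [mul_assoc] at e1 e2
    simp only [← Finset.mul_sum] at e1 e2
    rw [← e1]
    linarith
  have hc : current M o F x n = ∑ δ, metric M x n δ *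
      ∑ m, ∑ κ, ∑ l, HDelta M o F x m δ κ l * nabla₂ M F x m κ l := by
    simp only [current, Finset.mul_sum, mul_assoc]
    rw [Finset.sum_comm]
  have hg := congrFun (Matrix.mulVec_mulVec
    (fun l => ∑ m, ∑ κ, invMetric M x m κ * nabla₂ M F x m κ l) (metric M x) (invMetric M x)) n
  rw [metric_mul_invMetric M x hx, Matrix.one_mulVec] at hg
  simp only [hc, hX, mul_neg, Finset.sum_neg_distrib, neg_inj]
  exact hg

/-! ### The equations in components -/

theorem IsSmoothTwoForm.contDiffAt {U : Set (Fin 4 → ℝ)} (hF : IsSmoothTwoForm F U)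
    (hU : IsOpen U) (hx : x ∈ U) (m n : Fin 4) : ContDiffAt ℝ ∞ (fun y => F y m n) x :=
  (hF.1 m n).contDiffAt (hU.mem_nhds hx)

theorem IsSmoothTwoForm.hasPd {U : Set (Fin 4 → ℝ)} (hF : IsSmoothTwoForm F U)
    (hU : IsOpen U) (hx : x ∈ U) (i m n : Fin 4) :
    HasPd i (fun y => F y m n) (pd i (fun y => F y m n) x) x :=
  .of_differentiableAt ((hF.contDiffAt hU hx m n).differentiableAt (by simp)) i

theorem IsSmoothTwoForm.hasPd_pd {U : Set (Fin 4 → ℝ)} (hF : IsSmoothTwoForm F U)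
    (hU : IsOpen U) (hx : x ∈ U) (i j m n : Fin 4) :
    HasPd i (pd j fun y => F y m n) (pd i (pd j fun y => F y m n) x) x :=
  .of_differentiableAt ((contDiffAt_pd (hF.contDiffAt hU hx m n) j).differentiableAt (by simp)) i

theorem IsSmoothTwoForm.pd_antisymm {U : Set (Fin 4 → ℝ)} (hF : IsSmoothTwoForm F U)
    (hU : IsOpen U) (hx : x ∈ U) (i m n : Fin 4) :
    pd i (fun y => F y n m) x = -pd i (fun y => F y m n) x :=
  ((hF.hasPd hU hx i m n).neg.congr
    (Filter.mem_of_superset (hU.mem_nhds hx) fun y hy => hF.2 y hy n m)).eq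

theorem IsSmoothTwoForm.nabla₂_antisymm {U : Set (Fin 4 → ℝ)} (hF : IsSmoothTwoForm F U)
    (hU : IsOpen U) (hx : x ∈ U) (i m n : Fin 4) :
    nabla₂ M F x i n m = -nabla₂ M F x i m n := by
  simp only [nabla₂, hF.pd_antisymm hU hx i m n, hF.2 x hx n, hF.2 x hx _ m, mul_neg,
    Finset.sum_neg_distrib]
  ring

/-- In the first Maxwell–Born–Infeld equation the Christoffel symbols cancel: `dF = 0`. -/
theorem IsSmoothTwoForm.pd_cyclic {U : Set (Fin 4 → ℝ)} (hF : IsSmoothTwoForm F U)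
    (hU : IsOpen U) (hx : x ∈ U)
    (h : ∀ m n l, nabla₂ M F x m n l + nabla₂ M F x n l m + nabla₂ M F x l m n = 0)
    (m n l : Fin 4) :
    pd m (fun y => F y n l) x = pd n (fun y => F y m l) x - pd l (fun y => F y m n) x := by
  have hc : ∀ δ α β, christoffel M δ α β x = christoffel M δ β α x := by
    intro δ α β
    have hs : ∀ i, (fun y => metric M y α i) = fun y => metric M y i α := fun i => by
      funext y
      fin_cases α <;> fin_cases i <;> rfl
    simp only [christoffel, hs]
    refine congrArg _ (Finset.sum_congr rfl fun _ _ => ?_)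
    ring
  have h := h m n l
  simp only [nabla₂, hF.pd_antisymm hU hx n m l, hc _ n m, hc _ l m, hc _ l n,
    hF.2 x hx _ m, hF.2 x hx _ n, hF.2 x hx l, mul_neg, Finset.sum_neg_distrib] at h
  linarith

/-- The component `J_θ = -∂_a (g^{ab} F_{bθ}) + (r sin θ)⁻² ∂_φ F_{θφ}`, where `a`, `b` run over
`t*`, `r`. -/
theorem current_two {U : Set (Fin 4 → ℝ)} (hF : IsSmoothTwoForm F U)
    (hU : IsOpen U) (hUS : U ⊆ domain) (hx : x ∈ U)
    (hH : ∀ n, ∑ m, ∑ κ, ∑ l, H M o F x m n κ l * nabla₂ M F x m κ l = 0) :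
    current M o F x 2 =
      (1 + mu M x) * pd 0 (fun y => F y 0 2) x - mu M x * pd 0 (fun y => F y 1 2) x
        - mu M x * pd 1 (fun y => F y 0 2) x - (1 - mu M x) * pd 1 (fun y => F y 1 2) x
        + mu M x * (x 1)⁻¹ * (F x 0 2 - F x 1 2)
        + (x 1)⁻¹ ^ 2 * (Real.sin (x 2))⁻¹ ^ 2 * pd 3 (fun y => F y 2 3) x := by
  have h1 : x 1 ≠ 0 := (hUS hx).1.ne'
  have hs : Real.sin (x 2) ≠ 0 :=
    (Real.sin_pos_of_pos_of_lt_pi (hUS hx).2.1 (hUS hx).2.2).ne'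
  have hz : ∀ i, F x i i = 0 := fun i => by linarith [hF.2 x hx i i]
  have hz' : ∀ i j, pd j (fun y => F y i i) x = 0 := fun i j => by
    linarith [hF.pd_antisymm hU hx j i i]
  rw [current_eq_neg_div (hUS hx) (fun m κ l => hF.nabla₂_antisymm hU hx m κ l) hH]
  simp only [nabla₂, christoffel_eq M (hUS hx), invMetric, Fin.sum_univ_four, Matrix.of_apply,
    Matrix.cons_val, hF.pd_antisymm hU hx _ 2 3, hz, hz', hF.2 x hx 2 0, hF.2 x hx 2 1,
    hF.2 x hx 3 2]
  field_simp
  ring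

/-- The component `J_φ = -∂_a (g^{ab} F_{bφ}) - r⁻² sin θ ∂_θ (F_{θφ} / sin θ)`, where `a`, `b` run
over `t*`, `r`. -/
theorem current_three {U : Set (Fin 4 → ℝ)} (hF : IsSmoothTwoForm F U)
    (hU : IsOpen U) (hUS : U ⊆ domain) (hx : x ∈ U)
    (hH : ∀ n, ∑ m, ∑ κ, ∑ l, H M o F x m n κ l * nabla₂ M F x m κ l = 0) :
    current M o F x 3 =
      (1 + mu M x) * pd 0 (fun y => F y 0 3) x - mu M x * pd 0 (fun y => F y 1 3) x
        - mu M x * pd 1 (fun y => F y 0 3) x - (1 - mu M x) * pd 1 (fun y => F y 1 3) x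
        + mu M x * (x 1)⁻¹ * (F x 0 3 - F x 1 3)
        - (x 1)⁻¹ ^ 2 * (pd 2 (fun y => F y 2 3) x
          - Real.cos (x 2) * (Real.sin (x 2))⁻¹ * F x 2 3) := by
  have h1 : x 1 ≠ 0 := (hUS hx).1.ne'
  have hs : Real.sin (x 2) ≠ 0 :=
    (Real.sin_pos_of_pos_of_lt_pi (hUS hx).2.1 (hUS hx).2.2).ne'
  have hz : ∀ i, F x i i = 0 := fun i => by linarith [hF.2 x hx i i]
  have hz' : ∀ i j, pd j (fun y => F y i i) x = 0 := fun i j => by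
    linarith [hF.pd_antisymm hU hx j i i]
  rw [current_eq_neg_div (hUS hx) (fun m κ l => hF.nabla₂_antisymm hU hx m κ l) hH]
  simp only [nabla₂, christoffel_eq M (hUS hx), invMetric, Fin.sum_univ_four, Matrix.of_apply,
    Matrix.cons_val, hz, hz', hF.2 x hx 3 0, hF.2 x hx 3 1, hF.2 x hx 3 2]
  field_simp
  ring

theorem permSymbol_zero_one (α β : Fin 4) :
    permSymbol 0 1 α β = if α = 2 ∧ β = 3 then 1 else if α = 3 ∧ β = 2 then -1 else 0 := by
  rw [permSymbol_eq]
  fin_cases α <;> fin_cases β <;> norm_num <;> simp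

theorem sigma_eq (hx : x ∈ domain) (ha : ∀ m n, F x m n = -F x n m) :
    sigma M o F x = -2 * ((o : ℤ) : ℝ) * ((x 1)⁻¹ ^ 2 * ((Real.sin (x 2))⁻¹ * F x 2 3)) := by
  have h1 : x 1 ≠ 0 := hx.1.ne'
  have hs : Real.sin (x 2) ≠ 0 := (Real.sin_pos_of_pos_of_lt_pi hx.2.1 hx.2.2).ne'
  simp [sigma, raise₂, areaForm, vol, volDensity, permSymbol_swap 0 1, permSymbol_zero_one,
    Fin.sum_univ_four, invMetric, ha 3 2]
  field_simp
  ring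

/-- The two normalizations of the middle component agree up to the factor `-1/2` away from the
horizon. -/
theorem sigmaDual_eq (hx : x ∈ domain) (hr : mu M x ≠ 1) (ha : ∀ m n, F x m n = -F x n m) :
    sigmaDual M o F x = -(1 / 2) * sigma M o F x := by
  have h1 : x 1 ≠ 0 := hx.1.ne'
  have hs : Real.sin (x 2) ≠ 0 := (Real.sin_pos_of_pos_of_lt_pi hx.2.1 hx.2.2).ne'
  have hr : 1 - mu M x ≠ 0 := sub_ne_zero.2 hr.symm
  have h0 : ∀ i : Fin 4, hodge M o F x i i = 0 := fun i => by
    have h : ∀ α β : Fin 4, permSymbol i i α β = 0 := fun α β => by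
      linarith [permSymbol_swap i i α β]
    simp [hodge, vol, h]
  rw [sigma_eq hx ha]
  simp only [sigmaDual, Fin.sum_univ_four, h0, L, Lbar]
  simp [hodge, raise₂, vol, volDensity, permSymbol_swap 0 1, permSymbol_zero_one,
    Fin.sum_univ_four, invMetric, ha 3 2]
  field_simp
  ring

/-! ### The Fackerell–Ipser operator -/

theorem fackerellIpser_congr {s t : (Fin 4 → ℝ) → ℝ} (h : s =ᶠ[𝓝 x] t) :
    fackerellIpser M s x = fackerellIpser M t x := by
  have h0 : (fun y => y 1 ^ 2 * s y) =ᶠ[𝓝 x] fun y => y 1 ^ 2 * t y :=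
    h.mono fun y hy => by simp only [hy]
  have h1 : along (Lbar M) (fun y => y 1 ^ 2 * s y) =ᶠ[𝓝 x]
      along (Lbar M) (fun y => y 1 ^ 2 * t y) := by
    filter_upwards [Filter.eventually_all.2 fun m => pd_congr h0 m] with y hy
    simp only [along, hy]
  have h2 : (fun y => Real.sin (y 2) * pd 2 s y) =ᶠ[𝓝 x] fun y => Real.sin (y 2) * pd 2 t y :=
    (pd_congr h 2).mono fun y hy => by simp only [hy]
  unfold fackerellIpser sphereLaplacian
  rw [(pd_congr h2 2).eq_of_nhds, (pd_congr (pd_congr h 3) 3).eq_of_nhds]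
  simp only [along, fun m => (pd_congr h1 m).eq_of_nhds]

/-- The Fackerell–Ipser operator on `c P / (r² sin θ)`. The first group of terms is
`∂_a (g^{ab} ∂_b P)` over the `(t*, r)`-directions, because `L L̲ = -(1 - μ) ∂_a g^{ab} ∂_b`; the mixed
second derivative is written symmetrically. -/
theorem fackerellIpser_eq (hx : x ∈ domain) {P : (Fin 4 → ℝ) → ℝ} (hP : ContDiffAt ℝ ∞ P x)
    (c : ℝ) :
    fackerellIpser M (fun y => c * ((y 1)⁻¹ ^ 2 * ((Real.sin (y 2))⁻¹ * P y))) x =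
      c * (1 - mu M x) / (x 1 ^ 2 * Real.sin (x 2)) *
        (-((1 + mu M x) * pd 0 (pd 0 P) x - mu M x * (pd 0 (pd 1 P) x + pd 1 (pd 0 P) x)
            - (1 - mu M x) * pd 1 (pd 1 P) x + mu M x / x 1 * (pd 0 P x - pd 1 P x))
          + (x 1 ^ 2)⁻¹ * (pd 2 (pd 2 P) x - Real.cos (x 2) / Real.sin (x 2) * pd 2 P x
            + P x / Real.sin (x 2) ^ 2 + pd 3 (pd 3 P) x / Real.sin (x 2) ^ 2)) := by
  have h1 : x 1 ≠ 0 := hx.1.ne'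
  have hs : Real.sin (x 2) ≠ 0 := (Real.sin_pos_of_pos_of_lt_pi hx.2.1 hx.2.2).ne'
  have hev : ∀ᶠ y in 𝓝 x, y ∈ domain ∧ DifferentiableAt ℝ P y := by
    filter_upwards [isOpen_domain.mem_nhds hx,
      (hP.of_le (m := 1) (mod_cast le_top)).eventually (by simp)] with y hy hy'
    exact ⟨hy, hy'.differentiableAt (by simp)⟩
  have hd : ∀ i j, HasPd j (pd i P) (pd j (pd i P) x) x := fun i j =>
    .of_differentiableAt ((contDiffAt_pd hP i).differentiableAt (by simp)) j
  -- The inner derivatives are needed on a neighbourhood, the outer ones only at `x`.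
  have e1 : along (Lbar M) (fun y => y 1 ^ 2 * (c * ((y 1)⁻¹ ^ 2 * ((Real.sin (y 2))⁻¹ * P y))))
      =ᶠ[𝓝 x] fun y => c * ((Real.sin (y 2))⁻¹ * ((1 - mu M y) * (pd 0 P y - pd 1 P y))) := by
    filter_upwards [hev.eventually_nhds] with y hy
    obtain ⟨hy1, hy2⟩ := hy.self_of_nhds
    have h1 : y 1 ≠ 0 := hy1.1.ne'
    have hs : Real.sin (y 2) ≠ 0 := (Real.sin_pos_of_pos_of_lt_pi hy1.2.1 hy1.2.2).ne'
    have h : ∀ i, HasPd i (fun y => y 1 ^ 2 * (c * ((y 1)⁻¹ ^ 2 * ((Real.sin (y 2))⁻¹ * P y))))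
        _ y := fun i => ((hasPd_const c).mul ((hasPd_inv_sin hs i).mul
          (HasPd.of_differentiableAt hy2 i))).congr (hy.mono fun z hz => by
            have h1 : z 1 ≠ 0 := hz.1.1.ne'
            field_simp)
    simp only [along, Fin.sum_univ_four, (h _).eq, Lbar, Matrix.cons_val]
    simp
    ring
  have e2 : (fun y => Real.sin (y 2) *
        pd 2 (fun y => c * ((y 1)⁻¹ ^ 2 * ((Real.sin (y 2))⁻¹ * P y))) y)
      =ᶠ[𝓝 x] fun y => c * ((y 1)⁻¹ ^ 2 *
        (pd 2 P y - Real.cos (y 2) * ((Real.sin (y 2))⁻¹ * P y))) := by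
    filter_upwards [hev] with y hy
    have h1 : y 1 ≠ 0 := hy.1.1.ne'
    have hs : Real.sin (y 2) ≠ 0 := (Real.sin_pos_of_pos_of_lt_pi hy.1.2.1 hy.1.2.2).ne'
    rw [((hasPd_const c).mul ((hasPd_inv_r h1 2).sq.mul ((hasPd_inv_sin hs 2).mul
      (HasPd.of_differentiableAt hy.2 2)))).eq]
    simp
    field_simp
    ring
  have e3 : pd 3 (fun y => c * ((y 1)⁻¹ ^ 2 * ((Real.sin (y 2))⁻¹ * P y)))
      =ᶠ[𝓝 x] fun y => c * ((y 1)⁻¹ ^ 2 * ((Real.sin (y 2))⁻¹ * pd 3 P y)) := by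
    filter_upwards [hev] with y hy
    have h1 : y 1 ≠ 0 := hy.1.1.ne'
    have hs : Real.sin (y 2) ≠ 0 := (Real.sin_pos_of_pos_of_lt_pi hy.1.2.1 hy.1.2.2).ne'
    rw [((hasPd_const c).mul ((hasPd_inv_r h1 3).sq.mul ((hasPd_inv_sin hs 3).mul
      (HasPd.of_differentiableAt hy.2 3)))).eq]
    simp
  have f1 := fun i => (((hasPd_const c).mul ((hasPd_inv_sin hs i).mul
    (((hasPd_const 1).sub (hasPd_mu M h1 i)).mul ((hd 0 i).sub (hd 1 i))))).congr e1).eq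
  have hP' := HasPd.of_differentiableAt (hP.differentiableAt (by simp)) 2
  have f2 := (((hasPd_const c).mul ((hasPd_inv_r h1 2).sq.mul ((hd 2 2).sub
    ((hasPd_cos x 2).mul ((hasPd_inv_sin hs 2).mul hP'))))).congr e2).eq
  have f3 := (((hasPd_const c).mul ((hasPd_inv_r h1 3).sq.mul ((hasPd_inv_sin hs 3).mul
    (hd 3 3)))).congr e3).eq
  rw [fackerellIpser, sphereLaplacian, f2, f3]
  rw [along]
  simp only [Fin.sum_univ_four, f1, L, Matrix.cons_val,
    pd_comm (hP.of_le ENat.LEInfty.out) 0 1]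
  have hc : Real.cos (x 2) ^ 2 = 1 - Real.sin (x 2) ^ 2 := by
    linarith [Real.sin_sq_add_cos_sq (x 2)]
  simp
  field_simp
  ring_nf
  simp only [hc]
  ring

/-- The Fackerell–Ipser equation with `σ` written as `-2 o F_{θφ} / (r² sin θ)`. -/
theorem fackerellIpser_eq_NL₃ {U : Set (Fin 4 → ℝ)} (hF : IsSmoothTwoForm F U)
    (hU : IsOpen U) (hUS : U ⊆ domain) (hMBI : SolvesMBI M o F U) (hx : x ∈ U) :
    fackerellIpser M (fun y => -2 * ((o : ℤ) : ℝ) *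
      ((y 1)⁻¹ ^ 2 * ((Real.sin (y 2))⁻¹ * F y 2 3))) x = NL₃ M o F x := by
  have h1 : x 1 ≠ 0 := (hUS hx).1.ne'
  have hs : Real.sin (x 2) ≠ 0 :=
    (Real.sin_pos_of_pos_of_lt_pi (hUS hx).2.1 (hUS hx).2.2).ne'
  have hev : ∀ᶠ y in 𝓝 x, y ∈ U := hU.mem_nhds hx
  have k := fun i => hF.hasPd hU hx i
  have kk := fun i j => hF.hasPd_pd hU hx i j
  have km := hasPd_mu M h1
  have kr := fun i => hasPd_inv_r h1 i
  have ks := fun i => hasPd_inv_sin hs i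
  have k1 := fun i => hasPd_const (i := i) (x := x) 1
  have j2 := ((((((((k1 3).add (km 3)).mul (kk 3 0 0 2)).sub ((km 3).mul (kk 3 0 1 2))).sub
      ((km 3).mul (kk 3 1 0 2))).sub (((k1 3).sub (km 3)).mul (kk 3 1 1 2))).add
      (((km 3).mul (kr 3)).mul ((k 3 0 2).sub (k 3 1 2)))).add
      (((kr 3).sq.mul (ks 3).sq).mul (kk 3 3 2 3))).congr
    (hev.mono fun y hy => current_two hF hU hUS hy (hMBI.2 y hy))
  have j3 := ((((((((k1 2).add (km 2)).mul (kk 2 0 0 3)).sub ((km 2).mul (kk 2 0 1 3))).sub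
      ((km 2).mul (kk 2 1 0 3))).sub (((k1 2).sub (km 2)).mul (kk 2 1 1 3))).add
      (((km 2).mul (kr 2)).mul ((k 2 0 3).sub (k 2 1 3)))).sub
      ((kr 2).sq.mul ((kk 2 2 2 3).sub (((hasPd_cos x 2).mul (ks 2)).mul (k 2 2 3))))).congr
    (hev.mono fun y hy => current_three hF hU hUS hy (hMBI.2 y hy))
  -- `dF = 0` and its derivatives, with the second derivatives commuted to fit the curl of `J`.
  have b1 : ∀ a, ∀ᶠ y in 𝓝 x, pd a (fun y => F y 2 3) y =
      pd 2 (fun y => F y a 3) y - pd 3 (fun y => F y a 2) y := fun a =>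
    hev.mono fun y hy => hF.pd_cyclic hU hy (hMBI.1 y hy) a 2 3
  have b2 : ∀ a b, pd b (pd a (fun y => F y 2 3)) x =
      pd 2 (pd b fun y => F y a 3) x - pd 3 (pd b fun y => F y a 2) x := fun a b => by
    rw [(((kk b 2 a 3).sub (kk b 3 a 2)).congr (b1 a)).eq,
      pd_comm ((hF.contDiffAt hU hx a 3).of_le ENat.LEInfty.out),
      pd_comm ((hF.contDiffAt hU hx a 2).of_le ENat.LEInfty.out)]
  rw [NL₃_eq_curl (hUS hx) j2.diff j3.diff, j2.eq, j3.eq,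
    fackerellIpser_eq (hUS hx) (hF.contDiffAt hU hx 2 3)]
  simp only [b2 0, b2 1, (b1 0).self_of_nhds, (b1 1).self_of_nhds]
  have hc : Real.cos (x 2) ^ 2 = 1 - Real.sin (x 2) ^ 2 := by
    linarith [Real.sin_sq_add_cos_sq (x 2)]
  simp
  field_simp
  ring_nf
  simp only [hc]
  ring

end Schwarzschild

theorem lemma10p2 (M : ℝ) (hM : 0 < M) (o : ℤˣ)
    (U : Set (Fin 4 → ℝ)) (hU : IsOpen U) (hUS : U ⊆ Schwarzschild.domain)
    (F : (Fin 4 → ℝ) → Fin 4 → Fin 4 → ℝ) (hF : Schwarzschild.IsSmoothTwoForm F U)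
    (hℓ : ∀ x ∈ U, Schwarzschild.ellSq M o F x ≠ 0)
    (hMBI : Schwarzschild.SolvesMBI M o F U) :
    (∀ x ∈ U, Schwarzschild.fackerellIpser M (Schwarzschild.sigma M o F) x
        = Schwarzschild.NL₃ M o F x) ∧
    (∀ x ∈ U, x 1 ≠ 2 * M →
      Schwarzschild.fackerellIpser M (Schwarzschild.sigmaDual M o F) x
        = -(1 / 2) * Schwarzschild.NL₃ M o F x) := by
  open Schwarzschild in
  refine ⟨fun x hx => ?_, fun x hx hr => ?_⟩
  · rw [← fackerellIpser_eq_NL₃ hF hU hUS hMBI hx]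
    refine fackerellIpser_congr ?_
    filter_upwards [hU.mem_nhds hx] with y hy
    exact sigma_eq (hUS hy) (hF.2 y hy)
  · have hP := hF.contDiffAt hU hx 2 3
    rw [← fackerellIpser_eq_NL₃ hF hU hUS hMBI hx, fackerellIpser_eq (hUS hx) hP]
    have h : sigmaDual M o F =ᶠ[nhds x] fun y => ((o : ℤ) : ℝ) *
        ((y 1)⁻¹ ^ 2 * ((Real.sin (y 2))⁻¹ * F y 2 3)) := by
      filter_upwards [hU.mem_nhds hx, (continuous_apply 1).continuousAt.eventually_ne hr]
        with y hy hy1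
      have hmu : mu M y ≠ 1 := fun h => hy1 ((div_eq_one_iff_eq (hUS hy).1.ne').1 h).symm
      rw [sigmaDual_eq (hUS hy) hmu (hF.2 y hy), sigma_eq (hUS hy) (hF.2 y hy)]
      ring
    rw [fackerellIpser_congr h, fackerellIpser_eq (hUS hx) hP]
    ring
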